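/- Let $\mathbb{T}=\mathbb{R}/2\pi\mathbb{Z}$ and let $\mathcal{H}$ be the Hilbert transform on $\mathbb{T}$, $\widehat{\mathcal{H}f}(k)=-i\,\mathrm{sgn}(k)\widehat f(k)$ for $k\in\mathbb{Z}$. Let $L^2_0(\mathbb{T})$ be the space of real-valued $f\in L^2(\mathbb{T})$ with $\int_{\mathbb{T}}f\,dx=0$. Let $\mu\in\mathbb{R}$, $\alpha>0$, $T>0$, $0\le a<b\le 2\pi$, let $c\in L^2(0,T)$ be real-valued, and let $v\in L^2((0,T);L^2_0(\mathbb{T}))$ be a solution, in the sense of distributions on $\mathbb{T}\times(0,T)$ and with $2v\,\partial_xv$ understood as $\partial_x(v^2)$, of $$\partial_t v-\partial_x^3v-\alpha\mathcal{H}\partial_x^2v+2\mu\,\partial_xv+2v\,\partial_xv=0 .$$ If $v(x,t)=c(t)$ for almost every $(x,t)\in(a,b)\times(0,T)$, then $v(x,t)=0$ for almost every $(x,t)\in\mathbb{T}\times(0,T)$. -/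

import Mathlib

open MeasureTheory

namespace Benjamin

noncomputable section

/-- The torus `𝕋 = ℝ / 2πℤ`; its `volume` has total mass `2π`. -/
abbrev Torus : Type := AddCircle (2 * Real.pi)

instance instFactTwoPiPos : Fact (0 < 2 * Real.pi) := ⟨Real.two_pi_pos⟩

/-- Lebesgue measure on `𝕋 × (0, T)`; a point is written `p = (x, t)`. -/
def spaceTime (T : ℝ) : Measure (Torus × ℝ) :=
  (volume : Measure Torus).prod (volume.restrict (Set.Ioo 0 T))

/-- `v ∈ L²((0,T); L²_0(𝕋))`: a real-valued function, square integrable on `𝕋 × (0, T)`, such that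
`v(·, t)` has mean zero for almost every `t ∈ (0, T)`. -/
structure MemL2L20 (T : ℝ) (v : Torus × ℝ → ℝ) : Prop where
  memLp : MemLp v 2 (spaceTime T)
  mean_zero : ∀ᵐ t ∂(volume.restrict (Set.Ioo 0 T)), ∫ x : Torus, v (x, t) = 0

/-- The Hilbert transform on `𝕋`, i.e. the Fourier multiplier with symbol `-i sgn k`:
`𝓗 f (x) = ∑ₖ (-i sgn k) f̂(k) e^{ikx}`. It is used below for smooth `f` only, for which the series
converges absolutely. -/
def hilbert (f : Torus → ℂ) (x : Torus) : ℂ :=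
  ∑' k : ℤ, (-Complex.I * (Int.sign k : ℂ)) * fourierCoeff f k * fourier k x

/-- The partial derivative `∂ₓⁿ φ` at `p = (x, t)`, that is, the `n`-th derivative at `s = 0` of
`s ↦ φ(x + s, t)`. -/
def dx (n : ℕ) (φ : Torus × ℝ → ℂ) (p : Torus × ℝ) : ℂ :=
  iteratedDeriv n (fun s : ℝ => φ (p.1 + (s : Torus), p.2)) 0

/-- The partial derivative `∂ₜ φ`. -/
def dt (φ : Torus × ℝ → ℂ) (p : Torus × ℝ) : ℂ :=
  deriv (fun s : ℝ => φ (p.1, s)) p.2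

/-- The Hilbert transform in the space variable. -/
def hilbertX (φ : Torus × ℝ → ℂ) (p : Torus × ℝ) : ℂ :=
  hilbert (fun x => φ (x, p.2)) p.1

/-- (Complex-valued) test functions: smooth functions on `𝕋 × ℝ` with compact support contained in
`𝕋 × (0, T)`. Smoothness is that of the lift to `ℝ × ℝ`. -/
structure IsTestFunction (T : ℝ) (φ : Torus × ℝ → ℂ) : Prop where
  smooth : ContDiff ℝ (⊤ : ℕ∞) (fun q : ℝ × ℝ => φ ((q.1 : Torus), q.2))
  compactSupport : HasCompactSupport φ
  support_subset : tsupport φ ⊆ Set.univ ×ˢ Set.Ioo 0 T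

/-- `v` solves
`∂ₜ v - ∂ₓ³ v - α 𝓗 ∂ₓ² v + 2 μ ∂ₓ v + 2 v ∂ₓ v = 0` on `𝕋 × (0, T)` in the sense of distributions,
where `2 v ∂ₓ v` is read as `∂ₓ (v²)`. Under the pairing `∫ f g`, the transposes of
`∂ₜ`, `∂ₓ`, `∂ₓ³`, `𝓗 ∂ₓ²` are `-∂ₜ`, `-∂ₓ`, `-∂ₓ³`, `-𝓗 ∂ₓ²`: the symbol `-i sgn k` is odd, so the
transpose of `𝓗` is `-𝓗`, and `𝓗` commutes with `∂ₓ`. -/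
def IsSolution (α μ T : ℝ) (v : Torus × ℝ → ℝ) : Prop :=
  ∀ φ : Torus × ℝ → ℂ, IsTestFunction T φ →
    ∫ p, ((v p : ℂ) * (-dt φ p + dx 3 φ p + (α : ℂ) * hilbertX (dx 2 φ) p
            - 2 * (μ : ℂ) * dx 1 φ p)
          - (v p : ℂ) ^ 2 * dx 1 φ p) ∂(spaceTime T) = 0

end

end Benjamin

namespace Benjamin

open Filter Topology

/-! The nonlocal term turns local information into analyticity. Test the equation with `g'(x) θ(t)`,
where `g` is supported in the arc. There `v` and `v²` depend on `t` only, so every local term pairs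
a derivative of `g` with a constant in `x` and vanishes. Since `α ≠ 0`, the term `∫ v 𝓗g''' θ`
vanishes too (`integral_mul_hilbert_eq_zero`).

With `f = g'''`, also `∫ v f θ = 0`, and `f + i𝓗f` is twice the positive-frequency part of `f`.
Hence `∑ₙ f̂(n) Vₙ = 0` over `n ≥ 0`, where `Vₙ` is `pairing T v θ n`
(`tsum_fourierCoeff_mul_pairing`). Translating a fixed bump by `s` multiplies its `n`-th coefficient
by `e^{-isn}`, so a power series on the unit disc vanishes on a boundary arc. Its coefficients are
then zero (`coeff_eq_zero_of_tsum_eq_zero_on_arc`), and a narrow enough bump has a nonzero `n`-th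
coefficient, so `Vₙ = 0` for `n > 0` (`pairing_eq_zero_of_pos`).

Frequency zero is the mean-zero condition, and negative frequencies follow by conjugation because
`v` and `θ` are real. As `θ` is arbitrary, almost every slice `v(·, t)` has zero Fourier
coefficients. -/

/-! ### Boundary uniqueness for power series on the disc. -/

/-- A power series with absolutely summable coefficients whose sum vanishes on an arc of the unit
circle is zero. -/
theorem coeff_eq_zero_of_tsum_eq_zero_on_arc {d : ℕ → ℂ} (hd : Summable fun n => ‖d n‖)
    {s₁ s₂ : ℝ} (hs : s₁ < s₂)
    (h : ∀ s ∈ Set.Ioo s₁ s₂, ∑' n, d n * Complex.exp (s * Complex.I) ^ n = 0) (n : ℕ) :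
    d n = 0 := by
  set G : ℂ → ℂ := fun z => ∑' n, d n * z ^ n with hG
  have hbound : ∀ (n : ℕ) (z : ℂ), z ∈ Metric.closedBall (0 : ℂ) 1 → ‖d n * z ^ n‖ ≤ ‖d n‖ := by
    intro n z hz
    rw [mem_closedBall_zero_iff] at hz
    rw [norm_mul, norm_pow]
    exact mul_le_of_le_one_right (norm_nonneg _) (pow_le_one₀ (norm_nonneg _) hz)
  have hcont : ContinuousOn G (Metric.closedBall 0 1) :=
    continuousOn_tsum (fun n => by fun_prop) hd hbound
  have hdiff : DifferentiableOn ℂ G (Metric.ball 0 1) :=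
    Complex.differentiableOn_tsum_of_summable_norm hd (fun n => by fun_prop) Metric.isOpen_ball
      fun n z hz => hbound n z (Metric.ball_subset_closedBall hz)
  -- The rotation angle `w = 2π/N` is made shorter than the arc, so every point of the circle has
  -- one of its `N` rotates in the arc.
  obtain ⟨N, hN⟩ := exists_nat_gt (2 * Real.pi / (s₂ - s₁))
  have hpos : 0 < s₂ - s₁ := sub_pos.2 hs
  have hN0 : (0 : ℝ) < N := lt_trans (by positivity) hN
  set w : ℝ := 2 * Real.pi / N with hw
  have hw0 : 0 < w := by positivity
  have hws : w < s₂ - s₁ := by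
    rw [hw, div_lt_iff₀ hN0]
    rw [div_lt_iff₀ hpos] at hN
    linarith
  set ζ : ℂ := Complex.exp (w * Complex.I) with hζ
  have hζnorm : ‖ζ‖ = 1 := Complex.norm_exp_ofReal_mul_I w
  have hζN : ζ ^ N = 1 := by
    rw [hζ, ← Complex.exp_nat_mul, ← Complex.exp_two_pi_mul_I]
    congr 1
    rw [hw]
    have : (N : ℂ) ≠ 0 := by exact_mod_cast hN0.ne'
    push_cast
    field_simp
  have hrot_closed : ∀ j : ℕ, Set.MapsTo (fun z => z * ζ ^ j) (Metric.closedBall (0 : ℂ) 1)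
      (Metric.closedBall 0 1) := by
    intro j z hz
    simpa [hζnorm] using hz
  have hrot : ∀ j : ℕ, Set.MapsTo (fun z => z * ζ ^ j) (Metric.ball (0 : ℂ) 1)
      (Metric.ball 0 1) := by
    intro j z hz
    simpa [hζnorm] using hz
  have hcl : closure (Metric.ball (0 : ℂ) 1) = Metric.closedBall 0 1 :=
    closure_ball _ one_ne_zero
  -- On the circle some factor of this product vanishes at each point; the maximum principle then
  -- kills the product on the whole disc.
  have hP : DiffContOnCl ℂ (fun z => ∏ j ∈ Finset.range N, G (z * ζ ^ j)) (Metric.ball 0 1) := by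
    constructor
    · refine DifferentiableOn.fun_finsetProd fun j _ => ?_
      exact hdiff.comp (by fun_prop) (hrot j)
    · rw [hcl]
      refine continuousOn_finsetProd _ fun j _ => ?_
      exact hcont.comp (by fun_prop) (hrot_closed j)
  have hsphere : Set.EqOn (fun z => ∏ j ∈ Finset.range N, G (z * ζ ^ j)) (fun _ => 0)
      (frontier (Metric.ball 0 1)) := by
    intro z hz
    rw [frontier_ball _ one_ne_zero, mem_sphere_zero_iff_norm] at hz
    obtain ⟨m, hm1, hm2⟩ : ∃ m : ℤ, s₁ < z.arg + w * m ∧ z.arg + w * m < s₂ := by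
      refine ⟨⌊(s₁ - z.arg) / w⌋ + 1, ?_, ?_⟩
      · have := Int.lt_floor_add_one ((s₁ - z.arg) / w)
        rw [div_lt_iff₀ hw0] at this
        push_cast
        linarith
      · have := Int.floor_le ((s₁ - z.arg) / w)
        rw [le_div_iff₀ hw0] at this
        push_cast
        linarith
    have hNz : (N : ℤ) ≠ 0 := by exact_mod_cast hN0.ne'
    have hmod := Int.emod_nonneg m hNz
    have hmod' := Int.emod_lt_of_pos m (show (0 : ℤ) < N by exact_mod_cast hN0)
    refine Finset.prod_eq_zero (i := (m % N).toNat) (by rw [Finset.mem_range]; omega) ?_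
    have key : z * ζ ^ (m % N).toNat
        = Complex.exp (((z.arg + w * m : ℝ) : ℂ) * Complex.I) := by
      have h1 : ζ ^ (m % N).toNat = ζ ^ m := by
        rw [← zpow_natCast, Int.toNat_of_nonneg hmod]
        conv_rhs => rw [← Int.emod_add_mul_ediv m N,
          zpow_add₀ (Complex.exp_ne_zero _), zpow_mul, zpow_natCast, hζN, one_zpow, mul_one]
      rw [h1, hζ, ← Complex.exp_int_mul]
      conv_lhs => rw [← Complex.norm_mul_exp_arg_mul_I z, hz]
      rw [Complex.ofReal_one, one_mul, ← Complex.exp_add]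
      congr 1
      push_cast
      ring
    rw [key]
    exact h _ ⟨hm1, hm2⟩
  have hzero := Complex.eqOn_of_eqOn_frontier Metric.isBounded_ball hP
    (diffContOnCl_const (c := (0 : ℂ))) hsphere
  have hconn : IsPreconnected (Metric.ball (0 : ℂ) 1) := (convex_ball _ _).isPreconnected
  -- Analytic functions on a connected open set have no zero divisors, so a single rotate of `G`
  -- vanishes identically.
  have hfactor : ∀ s : Finset ℕ, (∀ z ∈ Metric.ball (0 : ℂ) 1, ∏ j ∈ s, G (z * ζ ^ j) = 0) →
      ∃ j, ∀ z ∈ Metric.ball (0 : ℂ) 1, G (z * ζ ^ j) = 0 := by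
    intro s
    induction s using Finset.induction_on with
    | empty => intro h0; simpa using h0 0 (by simp)
    | insert i s hi ih =>
      intro h0
      have hA : ∀ j : ℕ, DifferentiableOn ℂ (fun z => G (z * ζ ^ j)) (Metric.ball 0 1) :=
        fun j => hdiff.comp (by fun_prop) (hrot j)
      rcases AnalyticOnNhd.eq_zero_or_eq_zero_of_mul_eq_zero
        ((hA i).analyticOnNhd Metric.isOpen_ball)
        ((DifferentiableOn.fun_finsetProd (u := s) fun j _ => hA j).analyticOnNhd
          Metric.isOpen_ball)
        (fun z hz => by have := h0 z hz; rwa [Finset.prod_insert hi] at this) hconn with h1 | h1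
      · exact ⟨i, h1⟩
      · exact ih h1
  obtain ⟨j, hj⟩ := hfactor _ hzero
  have hG0 : ∀ z ∈ Metric.ball (0 : ℂ) 1, G z = 0 := by
    intro z hz
    have hne : ζ ^ j ≠ 0 := pow_ne_zero _ (Complex.exp_ne_zero _)
    have := hj (z * (ζ ^ j)⁻¹) (by simpa [hζnorm] using hz)
    rwa [mul_assoc, inv_mul_cancel₀ hne, mul_one] at this
  have hser : HasFPowerSeriesAt (0 : ℂ → ℂ) (FormalMultilinearSeries.ofScalars ℂ d) 0 := by
    rw [hasFPowerSeriesAt_iff]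
    filter_upwards [Metric.ball_mem_nhds (0 : ℂ) one_pos] with z hz
    have hsum : Summable fun n => d n * z ^ n :=
      Summable.of_norm_bounded hd fun n => hbound n z (Metric.ball_subset_closedBall hz)
    have := hsum.hasSum
    rw [show ∑' n, d n * z ^ n = 0 from hG0 z hz] at this
    simpa [FormalMultilinearSeries.coeff_ofScalars, mul_comm] using this
  rw [← FormalMultilinearSeries.coeff_ofScalars (𝕜 := ℂ) (p := d) (n := n), hser.eq_zero]
  rfl

/-! ### Derivatives and Fourier coefficients on the torus. -/

/-- The `n`-th derivative of a function on the torus. -/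
noncomputable def torusDeriv (n : ℕ) (g : Torus → ℂ) (x : Torus) : ℂ :=
  iteratedDeriv n (fun s : ℝ => g (x + (s : Torus))) 0

theorem torusDeriv_coe (n : ℕ) (g : Torus → ℂ) (y : ℝ) :
    torusDeriv n g (y : Torus) = iteratedDeriv n (fun y : ℝ => g (y : Torus)) y := by
  have := congrFun (iteratedDeriv_comp_const_add (n := n) (fun y : ℝ => g (y : Torus)) y) 0
  simpa [torusDeriv] using this

/-- Smoothness of a function on the torus, in terms of its lift to `ℝ`. -/
def TorusSmooth (g : Torus → ℂ) : Prop :=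
  ContDiff ℝ (⊤ : ℕ∞) (fun y : ℝ => g (y : Torus))

theorem torusDeriv_lift (n : ℕ) (g : Torus → ℂ) :
    (fun y : ℝ => torusDeriv n g (y : Torus)) = iteratedDeriv n (fun y : ℝ => g (y : Torus)) :=
  funext fun y => torusDeriv_coe n g y

theorem TorusSmooth.smooth_deriv {g : Torus → ℂ} (hg : TorusSmooth g) (n : ℕ) :
    TorusSmooth (torusDeriv n g) := by
  rw [TorusSmooth, torusDeriv_lift, iteratedDeriv_eq_iterate]
  exact ContDiff.iterate_deriv n hg

theorem torusDeriv_torusDeriv (m n : ℕ) (g : Torus → ℂ) :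
    torusDeriv m (torusDeriv n g) = torusDeriv (m + n) g := by
  funext x
  induction x using QuotientAddGroup.induction_on with
  | H y =>
    rw [torusDeriv_coe, torusDeriv_lift, torusDeriv_coe]
    simp only [iteratedDeriv_eq_iterate, Function.iterate_add_apply]

theorem TorusSmooth.hasDerivAt {g : Torus → ℂ} (hg : TorusSmooth g) (y : ℝ) :
    HasDerivAt (fun y : ℝ => g (y : Torus)) (torusDeriv 1 g (y : Torus)) y := by
  rw [torusDeriv_coe, iteratedDeriv_one]
  exact (hg.differentiable (by simp) y).hasDerivAt

theorem TorusSmooth.continuous {g : Torus → ℂ} (hg : TorusSmooth g) : Continuous g :=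
  continuous_coinduced_dom.2 (ContDiff.continuous hg)

theorem fourierCoeff_torusDeriv_one {g : Torus → ℂ} (hg : TorusSmooth g) (k : ℤ) :
    fourierCoeff (torusDeriv 1 g) k = Complex.I * k * fourierCoeff g k := by
  have hπ : (Real.pi : ℂ) ≠ 0 := by exact_mod_cast Real.pi_ne_zero
  have hint := intervalIntegral.integral_mul_deriv_eq_deriv_mul (a := 0) (b := 2 * Real.pi)
    (u := fun y : ℝ => fourier (-k) (y : Torus)) (v := fun y : ℝ => g (y : Torus))
    (fun y _ => hasDerivAt_fourier_neg (2 * Real.pi) k y) (fun y _ => hg.hasDerivAt y)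
    (Continuous.intervalIntegrable (continuous_const.mul
      ((fourier (T := 2 * Real.pi) (-k)).continuous.comp (AddCircle.continuous_mk' (2 * Real.pi)))) _ _)
    (((hg.smooth_deriv 1).continuous.comp (AddCircle.continuous_mk' (2 * Real.pi))).intervalIntegrable
      _ _)
  -- Periodicity cancels the boundary terms of the integration by parts.
  have hper : ((2 * Real.pi : ℝ) : Torus) = ((0 : ℝ) : Torus) := by
    rw [AddCircle.coe_period]; rfl
  rw [hper, sub_self, zero_sub] at hint
  rw [fourierCoeff_eq_intervalIntegral _ k 0, fourierCoeff_eq_intervalIntegral _ k 0, zero_add]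
  simp only [smul_eq_mul]
  rw [hint, ← intervalIntegral.integral_neg, mul_smul_comm, ← intervalIntegral.integral_const_mul]
  congr 1
  refine intervalIntegral.integral_congr fun y _ => ?_
  push_cast
  field_simp

theorem fourierCoeff_torusDeriv {g : Torus → ℂ} (hg : TorusSmooth g) (n : ℕ) (k : ℤ) :
    fourierCoeff (torusDeriv n g) k = (Complex.I * k) ^ n * fourierCoeff g k := by
  induction n with
  | zero =>
    have : torusDeriv 0 g = g := by funext x; simp [torusDeriv]
    simp [this]
  | succ n ih =>
    rw [add_comm, ← torusDeriv_torusDeriv, fourierCoeff_torusDeriv_one (hg.smooth_deriv n), ih,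
      add_comm, pow_succ]
    ring

/-- Two bounded derivatives give decay of order `1/k²`. -/
theorem summable_norm_fourierCoeff {g : Torus → ℂ} (hg : TorusSmooth g) :
    Summable fun k => ‖fourierCoeff g k‖ := by
  have hcont := (hg.smooth_deriv 2).continuous
  obtain ⟨C, hC⟩ : ∃ C, ∀ x, ‖torusDeriv 2 g x‖ ≤ C := by
    obtain ⟨x, hx⟩ := isCompact_univ.exists_bound_of_continuousOn hcont.continuousOn
    exact ⟨x, fun y => hx y trivial⟩
  have hC' : ∀ k, ‖fourierCoeff (torusDeriv 2 g) k‖ ≤ C := by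
    intro k
    refine (norm_integral_le_of_norm_le_const (C := C) (ae_of_all _ fun x => ?_)).trans ?_
    · rw [norm_smul]
      have : ‖fourier (-k) x‖ = 1 := Circle.norm_coe _
      rw [this, one_mul]
      exact hC x
    · simp
  refine Summable.of_norm_bounded_eventually (g := fun k : ℤ => C * (1 / (k : ℝ) ^ 2))
    ((Real.summable_one_div_int_pow.2 one_lt_two).mul_left C) ?_
  filter_upwards [(Set.finite_singleton (0 : ℤ)).compl_mem_cofinite] with k hk
  have hk0 : (k : ℝ) ≠ 0 := by exact_mod_cast hk
  have := hC' k
  rw [fourierCoeff_torusDeriv hg] at this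
  simp only [norm_mul, norm_pow, Complex.norm_I, one_mul, Complex.norm_intCast, sq_abs] at this
  rw [norm_norm, mul_one_div, le_div_iff₀ (by positivity)]
  linarith

theorem fourierCoeff_zero (g : Torus → ℂ) :
    fourierCoeff g 0 = ((2 * Real.pi)⁻¹ : ℝ) • ∫ x, g x := by
  rw [fourierCoeff, AddCircle.integral_haarAddCircle]
  simp

theorem integral_torusDeriv {g : Torus → ℂ} (hg : TorusSmooth g) {n : ℕ} (hn : n ≠ 0) :
    ∫ x, torusDeriv n g x = 0 := by
  have h := fourierCoeff_torusDeriv hg n 0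
  rw [fourierCoeff_zero] at h
  simpa [hn, Real.pi_ne_zero] using h

/-- The factor is written as a `k`-th power so that Fourier sums of translates become power series
in `e^{-is}`. -/
theorem fourierCoeff_comp_sub (g : Torus → ℂ) (s : ℝ) (k : ℤ) :
    fourierCoeff (fun x => g (x - (s : Torus))) k
      = Complex.exp (-(s * Complex.I)) ^ k * fourierCoeff g k := by
  rw [fourierCoeff, fourierCoeff, ← integral_const_mul,
    ← integral_sub_right_eq_self (fun x => Complex.exp (-(s * Complex.I)) ^ k *
      (fourier (-k) x • g x)) (s : Torus)]
  refine integral_congr_ae (ae_of_all _ fun x => ?_)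
  have : fourier (-k) x = fourier (-k) (s : Torus) * fourier (-k) (x - (s : Torus)) := by
    simp only [fourier_apply, smul_sub, sub_eq_add_neg (_ • x), AddCircle.toCircle_add,
      AddCircle.toCircle_neg, Circle.coe_mul, Circle.coe_inv]
    field_simp
  simp only [smul_eq_mul]
  rw [this, fourier_coe_apply, ← Complex.exp_int_mul]
  have hπ : (Real.pi : ℂ) ≠ 0 := by exact_mod_cast Real.pi_ne_zero
  rw [← mul_assoc]
  congr 3
  push_cast
  field_simp

/-! ### Bump functions supported in the arc. -/

/-- A smooth bump on the torus, positive exactly at distance less than `δ` from `s`. -/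
noncomputable def torusBump (δ s : ℝ) (x : Torus) : ℂ :=
  (Real.smoothTransition ((fourier 1 (x - (s : Torus)) : ℂ).re - Real.cos δ) : ℝ)

theorem torusBump_coe (δ s y : ℝ) :
    torusBump δ s (y : Torus) = (Real.smoothTransition (Real.cos (y - s) - Real.cos δ) : ℝ) := by
  have hπ : (Real.pi : ℂ) ≠ 0 := by exact_mod_cast Real.pi_ne_zero
  rw [torusBump, ← AddCircle.coe_sub, fourier_coe_apply]
  have : 2 * (Real.pi : ℂ) * Complex.I * (1 : ℤ) * ((y - s : ℝ) : ℂ) / ((2 * Real.pi : ℝ) : ℂ)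
      = ((y - s : ℝ) : ℂ) * Complex.I := by
    push_cast
    field_simp
  rw [this, Complex.exp_ofReal_mul_I_re]

theorem torusBump_eq_sub (δ s : ℝ) :
    torusBump δ s = fun x => torusBump δ 0 (x - (s : Torus)) := by
  funext x
  simp [torusBump]

theorem torusSmooth_torusBump (δ s : ℝ) : TorusSmooth (torusBump δ s) := by
  simp only [TorusSmooth, torusBump_coe]
  have h : ContDiff ℝ (⊤ : ℕ∞)
      (fun y : ℝ => Real.smoothTransition (Real.cos (y - s) - Real.cos δ)) :=
    Real.smoothTransition.contDiff.comp
      ((Real.contDiff_cos.comp (contDiff_id.sub contDiff_const)).sub contDiff_const)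
  exact Complex.ofRealCLM.contDiff.comp h

theorem abs_lt_of_cos_lt {δ r : ℝ} (hδ : 0 ≤ δ) (hr : |r| ≤ Real.pi)
    (h : Real.cos δ < Real.cos r) : |r| < δ := by
  by_contra! hle
  rw [← Real.cos_abs r] at h
  exact h.not_ge (Real.cos_le_cos_of_nonneg_of_le_pi hδ hr hle)

/-- With `r` the representative of `y - s` in `[-π, π)`, a point outside the arc has `|r| > δ`,
hence `cos (y - s) < cos δ`. This condition is open, so the bump vanishes near `y` together with all
its derivatives. -/
theorem torusDeriv_torusBump_eq_zero {δ s a b : ℝ} (hδ : 0 ≤ δ) (ha : a < s - δ) (hb : s + δ < b)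
    (n : ℕ) {x : Torus} (hx : x ∉ (fun x : ℝ => (x : Torus)) '' Set.Ioo a b) :
    torusDeriv n (torusBump δ s) x = 0 := by
  obtain ⟨δ', hδ', ha', hb'⟩ : ∃ δ', δ < δ' ∧ δ' ≤ s - a ∧ δ' ≤ b - s :=
    ⟨min (s - a) (b - s), by rw [lt_min_iff]; constructor <;> linarith, min_le_left _ _,
      min_le_right _ _⟩
  induction x using QuotientAddGroup.induction_on with
  | H y =>
    have hp := Real.two_pi_pos
    set r := toIcoMod hp (-Real.pi) (y - s) with hr
    have hrm : r ∈ Set.Ico (-Real.pi) Real.pi := by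
      have := toIcoMod_mem_Ico hp (-Real.pi) (y - s)
      rwa [show -Real.pi + 2 * Real.pi = Real.pi by ring] at this
    have hry : r + toIcoDiv hp (-Real.pi) (y - s) * (2 * Real.pi) = y - s := by
      have := toIcoMod_add_toIcoDiv_zsmul hp (-Real.pi) (y - s)
      rwa [zsmul_eq_mul] at this
    have hcos : Real.cos (y - s) = Real.cos r := by
      rw [← hry, Real.cos_add_int_mul_two_pi]
    have habs : |r| ≤ Real.pi := abs_le.2 ⟨hrm.1, hrm.2.le⟩
    have hlt : Real.cos (y - s) < Real.cos δ := by
      by_contra! hle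
      refine hx ⟨s + r, ?_, ?_⟩
      · have : |r| ≤ δ := by
          by_contra! hlt
          rw [hcos, ← Real.cos_abs r] at hle
          exact hle.not_gt (Real.cos_lt_cos_of_nonneg_of_le_pi hδ habs hlt)
        rw [abs_le] at this
        constructor <;> linarith
      · have : y = s + r + toIcoDiv hp (-Real.pi) (y - s) * (2 * Real.pi) := by linarith
        change ((s + r : ℝ) : Torus) = (y : Torus)
        rw [this, ← zsmul_eq_mul, AddCircle.coe_add _ (s + r), AddCircle.coe_zsmul,
          AddCircle.coe_period, smul_zero, add_zero]
    change torusDeriv n (torusBump δ s) (y : Torus) = 0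
    rw [torusDeriv_coe]
    have hev : (fun y : ℝ => torusBump δ s (y : Torus)) =ᶠ[𝓝 y] fun _ => 0 := by
      have hc : Continuous fun y : ℝ => Real.cos (y - s) := by fun_prop
      filter_upwards [hc.continuousAt.eventually_lt continuousAt_const hlt] with z hz
      rw [torusBump_coe, Real.smoothTransition.zero_of_nonpos (by linarith), Complex.ofReal_zero]
    rw [(hev.iteratedDeriv_eq n)]
    simp

/-- On the support `|n y| ≤ π/2`, so `cos (n y) ≥ 0` and the real part of the integrand is
nonnegative; it is positive at `0`. -/
theorem fourierCoeff_torusBump_ne_zero {δ : ℝ} (hδ : 0 < δ) (hδπ : δ ≤ Real.pi) (n : ℕ)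
    (hn : n * δ ≤ Real.pi / 2) : fourierCoeff (torusBump δ 0) n ≠ 0 := by
  intro h0
  have hπ : (Real.pi : ℂ) ≠ 0 := by exact_mod_cast Real.pi_ne_zero
  rw [fourierCoeff_eq_intervalIntegral _ _ (-Real.pi),
    show -Real.pi + 2 * Real.pi = Real.pi by ring] at h0
  have h1 : ∫ y in (-Real.pi)..Real.pi,
      fourier (-(n : ℤ)) (y : Torus) • torusBump δ 0 (y : Torus) = 0 := by
    simpa [Real.pi_ne_zero] using h0
  have hcont : Continuous fun y : ℝ =>
      fourier (-(n : ℤ)) (y : Torus) • torusBump δ 0 (y : Torus) := by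
    have h2 := (torusSmooth_torusBump δ 0).continuous.comp (AddCircle.continuous_mk' (2 * Real.pi))
    have h3 := (fourier (T := 2 * Real.pi) (-(n : ℤ))).continuous.comp
      (AddCircle.continuous_mk' (2 * Real.pi))
    exact h3.smul h2
  have hre : ∀ y : ℝ, (fourier (-(n : ℤ)) (y : Torus) • torusBump δ 0 (y : Torus)).re
      = Real.cos (n * y) * Real.smoothTransition (Real.cos y - Real.cos δ) := by
    intro y
    rw [torusBump_coe, sub_zero, smul_eq_mul, Complex.re_mul_ofReal, fourier_coe_apply]
    have : 2 * (Real.pi : ℂ) * Complex.I * (-(n : ℤ) : ℤ) * (y : ℂ) / ((2 * Real.pi : ℝ) : ℂ)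
        = ((-(n * y) : ℝ) : ℂ) * Complex.I := by
      push_cast
      field_simp
    rw [this, Complex.exp_ofReal_mul_I_re, Real.cos_neg]
  have hpos : 0 < ∫ y in (-Real.pi)..Real.pi,
      (fourier (-(n : ℤ)) (y : Torus) • torusBump δ 0 (y : Torus)).re := by
    refine intervalIntegral.integral_pos (by linarith [Real.pi_pos])
      (Complex.continuous_re.comp hcont).continuousOn (fun y hy => ?_) ⟨0, ?_, ?_⟩
    · rw [hre]
      rcases le_or_gt (Real.cos y) (Real.cos δ) with hle | hlt
      · rw [Real.smoothTransition.zero_of_nonpos (by linarith), mul_zero]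
      · refine mul_nonneg (Real.cos_nonneg_of_mem_Icc ?_) (Real.smoothTransition.nonneg _)
        have := abs_lt_of_cos_lt hδ.le (abs_le.2 ⟨hy.1.le, hy.2⟩) hlt
        rw [Set.mem_Icc, ← abs_le, abs_mul, Nat.abs_cast]
        exact (mul_le_mul_of_nonneg_left this.le n.cast_nonneg).trans hn
    · constructor <;> linarith [Real.pi_pos]
    · rw [hre, mul_zero, Real.cos_zero, one_mul]
      refine Real.smoothTransition.pos_of_pos (sub_pos.2 ?_)
      rw [← Real.cos_zero]
      exact Real.cos_lt_cos_of_nonneg_of_le_pi le_rfl hδπ hδ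
  have h4 := congrArg Complex.re h1
  rw [Complex.zero_re] at h4
  have h5 := Complex.reCLM.intervalIntegral_comp_comm
    (hcont.intervalIntegrable (μ := volume) (-Real.pi) Real.pi)
  simp only [Complex.reCLM_apply] at h5
  rw [h5, h4] at hpos
  exact lt_irrefl _ hpos

/-! ### Integrals against separated functions. -/

instance isFiniteMeasure_spaceTime (T : ℝ) : IsFiniteMeasure (spaceTime T) := by
  unfold spaceTime
  infer_instance

/-- A separated function `g(x) h(t)` with mean zero `g` supported in an arc is orthogonal to every
function which depends on `t` only on that arc. -/
theorem integral_mul_separated_eq_zero {T : ℝ} {A : Set Torus} {u : Torus × ℝ → ℂ} {C : ℝ → ℂ}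
    (hu : ∀ᵐ p ∂(spaceTime T), p.1 ∈ A → u p = C p.2) {g : Torus → ℂ} (h : ℝ → ℂ)
    (hg : ∀ x, x ∉ A → g x = 0) (hg0 : ∫ x, g x = 0) :
    ∫ p, u p * (g p.1 * h p.2) ∂(spaceTime T) = 0 := by
  have : ∫ p, u p * (g p.1 * h p.2) ∂(spaceTime T)
      = ∫ p : Torus × ℝ, g p.1 * (C p.2 * h p.2) ∂(spaceTime T) := by
    refine integral_congr_ae ?_
    filter_upwards [hu] with p hp
    by_cases hA : p.1 ∈ A
    · rw [hp hA]; ring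
    · rw [hg _ hA]; ring
  rw [this, spaceTime, integral_prod_mul g fun t => C t * h t, hg0, zero_mul]

theorem integrable_mul_separated {T : ℝ} {u : Torus × ℝ → ℂ} (hu : Integrable u (spaceTime T))
    {g : Torus → ℂ} (hg : Continuous g) {h : ℝ → ℂ} (hh : Continuous h)
    (hhs : HasCompactSupport h) :
    Integrable (fun p => u p * (g p.1 * h p.2)) (spaceTime T) := by
  obtain ⟨C, hC⟩ := isCompact_univ.exists_bound_of_continuousOn hg.continuousOn
  obtain ⟨D, hD⟩ := hhs.exists_bound_of_continuous hh
  refine hu.mul_bdd (c := C * D) (by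
    have : Continuous fun p : Torus × ℝ => g p.1 * h p.2 := by fun_prop
    exact this.aestronglyMeasurable) (ae_of_all _ fun p => ?_)
  rw [norm_mul]
  exact mul_le_mul (hC _ trivial) (hD _) (norm_nonneg _) ((norm_nonneg _).trans (hC p.1 trivial))

theorem MemL2L20.integrable {T : ℝ} {v : Torus × ℝ → ℝ} (hv : MemL2L20 T v) :
    Integrable (fun p => (v p : ℂ)) (spaceTime T) :=
  (hv.memLp.integrable one_le_two).ofReal

theorem MemL2L20.integrable_sq {T : ℝ} {v : Torus × ℝ → ℝ} (hv : MemL2L20 T v) :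
    Integrable (fun p => (v p : ℂ) ^ 2) (spaceTime T) := by
  have := hv.memLp.integrable_sq.ofReal (𝕜 := ℂ)
  simpa using this

/-! ### The Hilbert transform and positive frequencies. -/

theorem norm_hilbert_term_le (f : Torus → ℂ) (k : ℤ) (x : Torus) :
    ‖(-Complex.I * (Int.sign k : ℂ)) * fourierCoeff f k * fourier k x‖ ≤ ‖fourierCoeff f k‖ := by
  have h1 : ‖fourier k x‖ = 1 := Circle.norm_coe _
  have h2 : ‖(Int.sign k : ℂ)‖ ≤ 1 := by
    rcases Int.sign_trichotomy k with h | h | h <;> simp [h]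
  rw [norm_mul, norm_mul, norm_mul, h1, norm_neg, Complex.norm_I, one_mul, mul_one]
  exact mul_le_of_le_one_left (norm_nonneg _) h2

theorem continuous_hilbert {f : Torus → ℂ} (hf : TorusSmooth f) : Continuous (hilbert f) :=
  continuous_tsum (fun k => continuous_const.mul (fourier k).continuous)
    (summable_norm_fourierCoeff hf) fun k x => norm_hilbert_term_le f k x

theorem hilbert_mul_const (f : Torus → ℂ) (z : ℂ) (x : Torus) :
    hilbert (fun x => f x * z) x = hilbert f x * z := by
  rw [hilbert, hilbert, ← tsum_mul_right]
  congr 1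
  funext k
  have : fourierCoeff (fun x => f x * z) k = z * fourierCoeff f k := by
    rw [← fourierCoeff.const_mul]
    congr 1
    funext x
    ring
  rw [this]
  ring

/-- For mean zero `f`, `f + i 𝓗 f` is twice the projection of `f` to positive frequencies. -/
theorem hasSum_add_I_mul_hilbert {f : Torus → ℂ} (hf : TorusSmooth f) (h0 : fourierCoeff f 0 = 0)
    (x : Torus) :
    HasSum (fun n : ℕ => 2 * fourierCoeff f n * fourier (n : ℤ) x)
      (f x + Complex.I * hilbert f x) := by
  have hs := summable_norm_fourierCoeff hf
  have h1 : HasSum (fun k : ℤ => fourierCoeff f k * fourier k x) (f x) := by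
    have := has_pointwise_sum_fourier_series_of_summable (f := ⟨f, hf.continuous⟩) hs.of_norm x
    simpa using! this
  have h2 : HasSum (fun k : ℤ => (-Complex.I * (Int.sign k : ℂ)) * fourierCoeff f k * fourier k x)
      (hilbert f x) :=
    (Summable.of_norm_bounded hs fun k => norm_hilbert_term_le f k x).hasSum
  have h3 := h1.add (h2.mul_left Complex.I)
  -- The multiplier `1 + i(-i sgn k)` is `2` for `k > 0` and `0` for `k < 0`. At `k = 0` it is `1`,
  -- and `h0` removes the mismatch with `2`.
  rw [← (Nat.cast_injective (R := ℤ)).hasSum_iff] at h3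
  · convert h3 using 1
    funext n
    rcases Nat.eq_zero_or_pos n with rfl | hn
    · simp [h0]
    · have : Int.sign (n : ℤ) = 1 := Int.sign_eq_one_of_pos (by exact_mod_cast hn)
      simp only [Function.comp, this]
      push_cast
      linear_combination (fourierCoeff f n * fourier (n : ℤ) x) * Complex.I_mul_I
  · intro k hk
    have hk' : k < 0 := by
      by_contra! h
      exact hk ⟨k.toNat, Int.toNat_of_nonneg h⟩
    have : Int.sign k = -1 := Int.sign_eq_neg_one_of_neg hk'
    simp only [this]
    push_cast
    linear_combination (fourierCoeff f k * fourier k x) * Complex.I_mul_I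

/-! ### Separated test functions in the equation. -/

/-- Smooth real functions compactly supported in `(0, T)`. -/
structure IsTimeTest (T : ℝ) (θ : ℝ → ℝ) : Prop where
  smooth : ContDiff ℝ (⊤ : ℕ∞) θ
  compactSupport : HasCompactSupport θ
  support_subset : tsupport θ ⊆ Set.Ioo 0 T

theorem IsTimeTest.continuous_ofReal {T : ℝ} {θ : ℝ → ℝ} (hθ : IsTimeTest T θ) :
    Continuous fun t => (θ t : ℂ) :=
  Complex.continuous_ofReal.comp hθ.smooth.continuous

theorem IsTimeTest.hasCompactSupport_ofReal {T : ℝ} {θ : ℝ → ℝ} (hθ : IsTimeTest T θ) :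
    HasCompactSupport fun t => (θ t : ℂ) :=
  hθ.compactSupport.comp_left Complex.ofReal_zero

theorem IsTimeTest.hasDerivAt_ofReal {T : ℝ} {θ : ℝ → ℝ} (hθ : IsTimeTest T θ) (t : ℝ) :
    HasDerivAt (fun t => (θ t : ℂ)) (deriv θ t : ℝ) t :=
  ((hθ.smooth.differentiable (by simp)) t).hasDerivAt.ofReal_comp

theorem isTestFunction_separated {T : ℝ} {g : Torus → ℂ} (hg : TorusSmooth g) {θ : ℝ → ℝ}
    (hθ : IsTimeTest T θ) : IsTestFunction T (fun p => g p.1 * θ p.2) := by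
  have hsub : tsupport (fun p : Torus × ℝ => g p.1 * θ p.2) ⊆ Set.univ ×ˢ tsupport θ := by
    refine closure_minimal (fun p hp => ⟨trivial, subset_tsupport _ fun h0 => hp ?_⟩)
      (isClosed_univ.prod (isClosed_tsupport _))
    simp [h0]
  refine ⟨?_, ?_, ?_⟩
  · exact (ContDiff.comp (g := fun y : ℝ => g (y : Torus)) hg contDiff_fst).mul
      (Complex.ofRealCLM.contDiff.comp (hθ.smooth.comp contDiff_snd))
  · exact (isCompact_univ.prod hθ.compactSupport).of_isClosed_subset (isClosed_tsupport _) hsub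
  · exact hsub.trans (Set.prod_mono_right hθ.support_subset)

theorem dx_separated (n : ℕ) (g : Torus → ℂ) (h : ℝ → ℂ) (p : Torus × ℝ) :
    dx n (fun p => g p.1 * h p.2) p = torusDeriv n g p.1 * h p.2 := by
  simp only [dx, torusDeriv, mul_comm _ (h p.2)]
  rw [iteratedDeriv_const_mul_field]

theorem hilbertX_dx_separated (n : ℕ) (g : Torus → ℂ) (h : ℝ → ℂ) (p : Torus × ℝ) :
    hilbertX (dx n fun p => g p.1 * h p.2) p = hilbert (torusDeriv n g) p.1 * h p.2 := by
  rw [← hilbert_mul_const, hilbertX]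
  congr 1
  funext x
  exact dx_separated n g h (x, p.2)

theorem dt_separated {T : ℝ} (g : Torus → ℂ) {θ : ℝ → ℝ} (hθ : IsTimeTest T θ) (p : Torus × ℝ) :
    dt (fun p => g p.1 * θ p.2) p = g p.1 * (deriv θ p.2 : ℝ) :=
  ((hθ.hasDerivAt_ofReal p.2).const_mul (g p.1)).deriv

theorem integral_linear_combination {X : Type*} [MeasurableSpace X] {m : Measure X}
    {f₁ f₂ f₃ f₄ f₅ : X → ℂ} (h₁ : Integrable f₁ m) (h₂ : Integrable f₂ m) (h₃ : Integrable f₃ m)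
    (h₄ : Integrable f₄ m) (h₅ : Integrable f₅ m) {y z : ℂ} :
    ∫ p, -f₁ p + f₂ p + y * f₃ p - z * f₄ p - f₅ p ∂m
      = -∫ p, f₁ p ∂m + ∫ p, f₂ p ∂m + y * ∫ p, f₃ p ∂m - z * ∫ p, f₄ p ∂m - ∫ p, f₅ p ∂m := by
  have e₁ : Integrable (fun p => -f₁ p) m := h₁.neg
  have e₂ : Integrable (fun p => -f₁ p + f₂ p) m := e₁.add h₂
  have e₃ : Integrable (fun p => -f₁ p + f₂ p + y * f₃ p) m := e₂.add (h₃.const_mul y)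
  have e₄ : Integrable (fun p => -f₁ p + f₂ p + y * f₃ p - z * f₄ p) m := e₃.sub (h₄.const_mul z)
  rw [integral_sub e₄ h₅, integral_sub e₃ (h₄.const_mul z), integral_add e₂ (h₃.const_mul y),
    integral_add e₁ h₂, integral_neg, integral_const_mul, integral_const_mul]

/-- For a solution depending on `t` only over the arc `A`, the Hilbert transform term of the
equation vanishes over `A` after one differentiation. -/
theorem integral_mul_hilbert_eq_zero {α μ T : ℝ} (hα : α ≠ 0) {v : Torus × ℝ → ℝ}
    (hv : MemL2L20 T v) (hsol : IsSolution α μ T v) {A : Set Torus} {c : ℝ → ℝ}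
    (hvc : ∀ᵐ p ∂(spaceTime T), p.1 ∈ A → v p = c p.2) {g : Torus → ℂ} (hg : TorusSmooth g)
    (hgA : ∀ n, ∀ x, x ∉ A → torusDeriv n g x = 0) {θ : ℝ → ℝ} (hθ : IsTimeTest T θ) :
    ∫ p, (v p : ℂ) * (hilbert (torusDeriv 3 g) p.1 * θ p.2) ∂(spaceTime T) = 0 := by
  have hv1 : ∀ᵐ p ∂(spaceTime T), p.1 ∈ A → (v p : ℂ) = ((c p.2 : ℝ) : ℂ) := by
    filter_upwards [hvc] with p hp hA
    rw [hp hA]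
  have hv2 : ∀ᵐ p ∂(spaceTime T), p.1 ∈ A → (v p : ℂ) ^ 2 = ((c p.2 : ℝ) : ℂ) ^ 2 := by
    filter_upwards [hvc] with p hp hA
    rw [hp hA]
  have hθc := hθ.continuous_ofReal
  have hθs := hθ.hasCompactSupport_ofReal
  have hθc' : Continuous fun t => ((deriv θ t : ℝ) : ℂ) :=
    Complex.continuous_ofReal.comp (hθ.smooth.continuous_deriv (by simp))
  have hθs' : HasCompactSupport fun t => ((deriv θ t : ℝ) : ℂ) :=
    hθ.compactSupport.deriv.comp_left Complex.ofReal_zero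
  have hgc := fun n => (hg.smooth_deriv n).continuous
  have z1 := integral_mul_separated_eq_zero (C := fun t => (c t : ℂ)) hv1
    (fun t => ((deriv θ t : ℝ) : ℂ)) (hgA 1)
    (integral_torusDeriv hg one_ne_zero)
  have z4 := integral_mul_separated_eq_zero (C := fun t => (c t : ℂ)) hv1
    (fun t => (θ t : ℂ)) (hgA 4)
    (integral_torusDeriv hg four_ne_zero)
  have z2 := integral_mul_separated_eq_zero (C := fun t => (c t : ℂ)) hv1
    (fun t => (θ t : ℂ)) (hgA 2)
    (integral_torusDeriv hg two_ne_zero)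
  have z2' := integral_mul_separated_eq_zero (C := fun t => (c t : ℂ) ^ 2) hv2
    (fun t => (θ t : ℂ)) (hgA 2)
    (integral_torusDeriv hg two_ne_zero)
  have i1 := integrable_mul_separated hv.integrable (hgc 1) hθc' hθs'
  have i4 := integrable_mul_separated hv.integrable (hgc 4) hθc hθs
  have i2 := integrable_mul_separated hv.integrable (hgc 2) hθc hθs
  have i2' := integrable_mul_separated hv.integrable_sq (hgc 2) hθc hθs
  have iH := integrable_mul_separated hv.integrable (continuous_hilbert (hg.smooth_deriv 3)) hθc hθs
  -- Testing with `g'` instead of `g` gives the `∂ₜ` term a mean-zero space factor as well.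
  have key := hsol _ (isTestFunction_separated (hg.smooth_deriv 1) hθ)
  have hH : ∀ p : Torus × ℝ, hilbertX (dx 2 fun p => torusDeriv 1 g p.1 * θ p.2) p
      = hilbert (torusDeriv 3 g) p.1 * θ p.2 := by
    intro p
    rw [hilbertX_dx_separated 2 (torusDeriv 1 g) (fun t => (θ t : ℂ)), torusDeriv_torusDeriv]
  have hsplit : ∀ p : Torus × ℝ,
      ((v p : ℂ) * (-dt (fun p => torusDeriv 1 g p.1 * θ p.2) p
            + dx 3 (fun p => torusDeriv 1 g p.1 * θ p.2) p
            + (α : ℂ) * hilbertX (dx 2 fun p => torusDeriv 1 g p.1 * θ p.2) p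
            - 2 * (μ : ℂ) * dx 1 (fun p => torusDeriv 1 g p.1 * θ p.2) p)
          - (v p : ℂ) ^ 2 * dx 1 (fun p => torusDeriv 1 g p.1 * θ p.2) p)
      = (((-((v p : ℂ) * (torusDeriv 1 g p.1 * (deriv θ p.2 : ℝ)))
          + (v p : ℂ) * (torusDeriv 4 g p.1 * θ p.2))
          + α * ((v p : ℂ) * (hilbert (torusDeriv 3 g) p.1 * θ p.2)))
          - 2 * μ * ((v p : ℂ) * (torusDeriv 2 g p.1 * θ p.2)))
          - (v p : ℂ) ^ 2 * (torusDeriv 2 g p.1 * θ p.2) := by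
    intro p
    rw [hH, dt_separated _ hθ, dx_separated 3 (torusDeriv 1 g) (fun t => (θ t : ℂ)),
      dx_separated 1 (torusDeriv 1 g) (fun t => (θ t : ℂ)), torusDeriv_torusDeriv,
      torusDeriv_torusDeriv]
    ring
  simp only [hsplit] at key
  rw [integral_linear_combination i1 i4 iH i2 i2', z1, z4, z2, z2'] at key
  have hα' : (α : ℂ) ≠ 0 := by exact_mod_cast hα
  simpa [hα'] using key

/-! ### Vanishing of the positive frequencies. -/

/-- The space-time Fourier coefficient of `v` tested against `θ` in time. -/
noncomputable def pairing (T : ℝ) (v : Torus × ℝ → ℝ) (θ : ℝ → ℝ) (k : ℤ) : ℂ :=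
  ∫ p, (v p : ℂ) * (fourier k p.1 * θ p.2) ∂(spaceTime T)

theorem integrable_pairing {T : ℝ} {v : Torus × ℝ → ℝ} (hv : MemL2L20 T v) {θ : ℝ → ℝ}
    (hθ : IsTimeTest T θ) (k : ℤ) :
    Integrable (fun p => (v p : ℂ) * (fourier k p.1 * θ p.2)) (spaceTime T) :=
  integrable_mul_separated hv.integrable (fourier k).continuous hθ.continuous_ofReal
    hθ.hasCompactSupport_ofReal

theorem norm_pairing_integrand (v : Torus × ℝ → ℝ) (θ : ℝ → ℝ) (k : ℤ) (p : Torus × ℝ) :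
    ‖(v p : ℂ) * (fourier k p.1 * θ p.2)‖ = |v p| * |θ p.2| := by
  have h1 : ‖fourier k p.1‖ = 1 := Circle.norm_coe _
  rw [norm_mul, norm_mul, h1, one_mul, Complex.norm_real, Complex.norm_real, Real.norm_eq_abs,
    Real.norm_eq_abs]

theorem norm_pairing_le (T : ℝ) (v : Torus × ℝ → ℝ) (θ : ℝ → ℝ) (k : ℤ) :
    ‖pairing T v θ k‖ ≤ ∫ p, |v p| * |θ p.2| ∂(spaceTime T) := by
  refine (norm_integral_le_integral_norm _).trans_eq ?_
  simp only [norm_pairing_integrand]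

/-- The expansion of `f + i𝓗f` in nonnegative frequencies is integrated term by term against `v θ`;
summability of `f̂` justifies the exchange. -/
theorem tsum_fourierCoeff_mul_pairing {T : ℝ} {v : Torus × ℝ → ℝ} (hv : MemL2L20 T v) {θ : ℝ → ℝ}
    (hθ : IsTimeTest T θ) {f : Torus → ℂ} (hf : TorusSmooth f) (h0 : fourierCoeff f 0 = 0)
    (h1 : ∫ p, (v p : ℂ) * (f p.1 * θ p.2) ∂(spaceTime T) = 0)
    (h2 : ∫ p, (v p : ℂ) * (hilbert f p.1 * θ p.2) ∂(spaceTime T) = 0) :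
    ∑' n : ℕ, fourierCoeff f n * pairing T v θ n = 0 := by
  have hs : Summable fun n : ℕ => ‖fourierCoeff f n‖ :=
    (summable_norm_fourierCoeff hf).comp_injective (Nat.cast_injective (R := ℤ))
  have hsum := hasSum_integral_of_summable_integral_norm (μ := spaceTime T)
    (F := fun (n : ℕ) p => 2 * fourierCoeff f n * ((v p : ℂ) * (fourier (n : ℤ) p.1 * θ p.2)))
    (fun n => (integrable_pairing hv hθ n).const_mul _) (by
      refine ((hs.mul_left 2).mul_right (∫ p, |v p| * |θ p.2| ∂(spaceTime T))).congr fun n => ?_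
      rw [← integral_const_mul]
      congr 1
      funext p
      rw [norm_mul, norm_pairing_integrand, norm_mul, Complex.norm_ofNat])
  have hpt : ∀ p : Torus × ℝ,
      ∑' n : ℕ, 2 * fourierCoeff f n * ((v p : ℂ) * (fourier (n : ℤ) p.1 * θ p.2))
        = (v p : ℂ) * (f p.1 * θ p.2) + Complex.I * ((v p : ℂ) * (hilbert f p.1 * θ p.2)) := by
    intro p
    have := (hasSum_add_I_mul_hilbert hf h0 p.1).mul_right ((v p : ℂ) * θ p.2)
    rw [show (v p : ℂ) * (f p.1 * θ p.2) + Complex.I * ((v p : ℂ) * (hilbert f p.1 * θ p.2))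
      = (f p.1 + Complex.I * hilbert f p.1) * ((v p : ℂ) * θ p.2) by ring, ← this.tsum_eq]
    congr 1
    funext n
    ring
  simp only [hpt, integral_const_mul] at hsum
  rw [integral_add (integrable_mul_separated hv.integrable hf.continuous hθ.continuous_ofReal
      hθ.hasCompactSupport_ofReal) ((integrable_mul_separated hv.integrable (continuous_hilbert hf)
      hθ.continuous_ofReal hθ.hasCompactSupport_ofReal).const_mul _), integral_const_mul, h1, h2,
      mul_zero, add_zero] at hsum
  have h3 := hsum.mul_left (1 / 2)
  rw [mul_zero] at h3
  rw [← h3.tsum_eq]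
  congr 1
  funext n
  rw [pairing]
  ring

theorem pairing_eq_zero_of_pos {α μ T a b : ℝ} (hα : α ≠ 0) (hab : a < b) {v : Torus × ℝ → ℝ}
    (hv : MemL2L20 T v) (hsol : IsSolution α μ T v) {c : ℝ → ℝ}
    (hvc : ∀ᵐ p ∂(spaceTime T),
      p.1 ∈ (fun x : ℝ => (x : Torus)) '' Set.Ioo a b → v p = c p.2)
    {θ : ℝ → ℝ} (hθ : IsTimeTest T θ) {n : ℕ} (hn : 0 < n) : pairing T v θ n = 0 := by
  have hn1 : (1 : ℝ) ≤ n := by exact_mod_cast hn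
  have hn0 : (0 : ℝ) < n := by linarith
  have hπ := Real.pi_pos
  -- The first bound leaves an open interval `(a + δ, b - δ)` of admissible centres; the second
  -- makes the `n`-th coefficient of the bump nonzero.
  set δ : ℝ := min ((b - a) / 4) (Real.pi / 2 / n) with hδdef
  have hδ : 0 < δ := lt_min (by linarith) (by positivity)
  have hδn : n * δ ≤ Real.pi / 2 := by
    have := min_le_right ((b - a) / 4) (Real.pi / 2 / n)
    rw [le_div_iff₀ hn0] at this
    linarith
  have hδπ : δ ≤ Real.pi := by nlinarith
  have hδab : δ ≤ (b - a) / 4 := min_le_left _ _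
  have hcoef : ∀ (s : ℝ) (k : ℤ), fourierCoeff (torusDeriv 3 (torusBump δ s)) k
      = fourierCoeff (torusDeriv 3 (torusBump δ 0)) k * Complex.exp (-(s * Complex.I)) ^ k := by
    intro s k
    rw [fourierCoeff_torusDeriv (torusSmooth_torusBump _ _),
      fourierCoeff_torusDeriv (torusSmooth_torusBump _ _), torusBump_eq_sub,
      fourierCoeff_comp_sub]
    ring
  have hsm := (torusSmooth_torusBump δ 0).smooth_deriv 3
  have hsum : Summable fun m : ℕ =>
      ‖fourierCoeff (torusDeriv 3 (torusBump δ 0)) m * pairing T v θ m‖ := by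
    have hs : Summable fun n : ℕ => ‖fourierCoeff (torusDeriv 3 (torusBump δ 0)) n‖ :=
      (summable_norm_fourierCoeff hsm).comp_injective (Nat.cast_injective (R := ℤ))
    refine Summable.of_nonneg_of_le (fun _ => norm_nonneg _) (fun m => ?_)
      (hs.mul_right (∫ p, |v p| * |θ p.2| ∂(spaceTime T)))
    rw [norm_mul]
    exact mul_le_mul_of_nonneg_left (norm_pairing_le _ _ _ _) (norm_nonneg _)
  -- The series is evaluated at `e^{ir}` with `r = -s`, because translation by `s` contributes
  -- `e^{-is}`.
  have hzero := coeff_eq_zero_of_tsum_eq_zero_on_arc hsum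
    (show -(b - δ) < -(a + δ) by linarith) (fun r hr => by
      set s := -r with hs
      have hsm := torusSmooth_torusBump δ s
      have hA : ∀ k x, x ∉ (fun x : ℝ => (x : Torus)) '' Set.Ioo a b →
          torusDeriv k (torusBump δ s) x = 0 := fun k x hx =>
        torusDeriv_torusBump_eq_zero hδ.le (by linarith [hr.2]) (by linarith [hr.1]) k hx
      have hv1 : ∀ᵐ p ∂(spaceTime T), p.1 ∈ (fun x : ℝ => (x : Torus)) '' Set.Ioo a b →
          (v p : ℂ) = ((c p.2 : ℝ) : ℂ) := by
        filter_upwards [hvc] with p hp hA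
        rw [hp hA]
      have := tsum_fourierCoeff_mul_pairing hv hθ (hsm.smooth_deriv 3)
        (by rw [fourierCoeff_torusDeriv hsm]; simp)
        (integral_mul_separated_eq_zero (C := fun t => (c t : ℂ)) hv1
          (fun t => (θ t : ℂ)) (hA 3) (integral_torusDeriv hsm three_ne_zero))
        (integral_mul_hilbert_eq_zero hα hv hsol hvc hsm hA hθ)
      rw [← this]
      congr 1
      funext m
      rw [hcoef s, hs, zpow_natCast]
      push_cast
      rw [neg_mul, neg_neg]
      ring) n
  refine (mul_eq_zero.1 hzero).resolve_left ?_
  rw [fourierCoeff_torusDeriv (torusSmooth_torusBump _ _)]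
  refine mul_ne_zero (pow_ne_zero _ (mul_ne_zero Complex.I_ne_zero ?_))
    (fourierCoeff_torusBump_ne_zero hδ hδπ n hδn)
  exact_mod_cast hn.ne'

/-! ### From vanishing pairings to `v = 0`. -/

theorem pairing_neg (T : ℝ) (v : Torus × ℝ → ℝ) (θ : ℝ → ℝ) (k : ℤ) :
    pairing T v θ (-k) = (starRingEnd ℂ) (pairing T v θ k) := by
  rw [pairing, pairing, ← integral_conj]
  simp only [map_mul, Complex.conj_ofReal, fourier_neg]

/-- The Fourier coefficients of `v(·, t)`, as functions of `t`. -/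
theorem pairing_eq_integral {T : ℝ} {v : Torus × ℝ → ℝ} (hv : MemL2L20 T v) {θ : ℝ → ℝ}
    (hθ : IsTimeTest T θ) (k : ℤ) :
    pairing T v θ k
      = ∫ t in Set.Ioo 0 T, θ t • ∫ x : Torus, (v (x, t) : ℂ) * fourier k x := by
  rw [pairing, spaceTime, integral_prod_symm _ (integrable_pairing hv hθ k)]
  refine integral_congr_ae (ae_of_all _ fun t => ?_)
  change _ = θ t • _
  rw [Complex.real_smul, ← integral_const_mul]
  exact integral_congr_ae (ae_of_all _ fun x => by ring)

theorem pairing_zero {T : ℝ} {v : Torus × ℝ → ℝ} (hv : MemL2L20 T v) {θ : ℝ → ℝ}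
    (hθ : IsTimeTest T θ) : pairing T v θ 0 = 0 := by
  rw [pairing_eq_integral hv hθ]
  refine integral_eq_zero_of_ae ?_
  filter_upwards [hv.mean_zero] with t ht
  have : ∫ x : Torus, (v (x, t) : ℂ) = 0 := by
    rw [integral_complex_ofReal, ht, Complex.ofReal_zero]
  simp [this]

/-- Completeness of the Fourier basis in `L²`. -/
theorem ae_eq_zero_of_integral_mul_fourier_eq_zero {f : Torus → ℂ} (hf : MemLp f 2 volume)
    (h : ∀ k : ℤ, ∫ x, f x * fourier k x = 0) : f =ᵐ[volume] 0 := by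
  have hf' : MemLp f 2 AddCircle.haarAddCircle := memLp_haarAddCircle_iff.2 hf
  have h0 : hf'.toLp f = 0 := by
    rw [← fourierBasis.repr.map_eq_zero_iff]
    ext k
    rw [fourierBasis_repr, fourierCoeff_congr_ae hf'.coeFn_toLp, fourierCoeff,
      AddCircle.integral_haarAddCircle]
    simp only [smul_eq_mul, mul_comm _ (f _)]
    rw [h, smul_zero]
    rfl
  have h1 : f =ᵐ[AddCircle.haarAddCircle] 0 := by
    filter_upwards [hf'.coeFn_toLp, Lp.coeFn_zero ℂ 2 (AddCircle.haarAddCircle (T := 2 * Real.pi))]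
      with x hx hx0
    rw [← hx, h0, hx0]
  rw [AddCircle.volume_eq_smul_haarAddCircle]
  exact Measure.ae_smul_measure h1 _

/-- The fundamental lemma of the calculus of variations in `t` treats each `k`; countably many `k`
share one null set of times. -/
theorem ae_eq_zero_of_pairing_eq_zero {T : ℝ} {v : Torus × ℝ → ℝ} (hv : MemL2L20 T v)
    (h : ∀ θ, IsTimeTest T θ → ∀ k, pairing T v θ k = 0) : ∀ᵐ p ∂(spaceTime T), v p = 0 := by
  have hcoef : ∀ k : ℤ, ∀ᵐ t ∂(volume.restrict (Set.Ioo 0 T)),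
      ∫ x : Torus, (v (x, t) : ℂ) * fourier k x = 0 := by
    intro k
    have hint : Integrable (fun p : Torus × ℝ => (v p : ℂ) * fourier k p.1) (spaceTime T) := by
      refine hv.integrable.mul_bdd (c := 1) ?_ (ae_of_all _ fun p => ?_)
      · exact ((fourier k).continuous.comp continuous_fst).aestronglyMeasurable
      · exact (Circle.norm_coe _).le
    have := IsOpen.ae_eq_zero_of_integral_contDiff_smul_eq_zero
      (μ := volume.restrict (Set.Ioo 0 T)) (isOpen_Ioo (a := (0 : ℝ)) (b := T))
      (hint.integral_prod_right.locallyIntegrable.locallyIntegrableOn _)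
      (fun g hg hgs hgt => by
        rw [← h g ⟨hg, hgs, hgt⟩ k, pairing_eq_integral hv ⟨hg, hgs, hgt⟩])
    filter_upwards [this, ae_restrict_mem measurableSet_Ioo] with t ht htm using ht htm
  -- Slicewise vanishing is recorded through `∫ v²`, so that Fubini carries it to the product.
  have hslice : ∀ᵐ t ∂(volume.restrict (Set.Ioo 0 T)), ∫ x : Torus, v (x, t) ^ 2 = 0 := by
    have hsq : Integrable (fun p => v p ^ 2) (spaceTime T) := hv.memLp.integrable_sq
    filter_upwards [ae_all_iff.2 hcoef, hsq.prod_left_ae,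
      (hv.memLp.integrable one_le_two).prod_left_ae] with t h1 h2 h3
    have hmem : MemLp (fun x : Torus => v (x, t)) 2 volume :=
      (memLp_two_iff_integrable_sq h3.aestronglyMeasurable).2 h2
    have := ae_eq_zero_of_integral_mul_fourier_eq_zero hmem.ofReal h1
    refine integral_eq_zero_of_ae ?_
    filter_upwards [this] with x hx
    have hx' : v (x, t) = 0 := by simpa using hx
    simp [hx']
  have hsq : Integrable (fun p => v p ^ 2) (spaceTime T) := hv.memLp.integrable_sq
  have hzero : ∫ p, v p ^ 2 ∂(spaceTime T) = 0 := by
    rw [spaceTime, integral_prod_symm _ hsq]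
    exact integral_eq_zero_of_ae hslice
  rw [integral_eq_zero_iff_of_nonneg (fun p => sq_nonneg _) hsq] at hzero
  filter_upwards [hzero] with p hp
  simpa using hp

end Benjamin

theorem proposition4p11 (α μ T a b : ℝ) (hα : 0 < α) (hT : 0 < T)
    (ha : 0 ≤ a) (hab : a < b) (hb : b ≤ 2 * Real.pi)
    (c : ℝ → ℝ) (hc : MemLp c 2 (volume.restrict (Set.Ioo 0 T)))
    (v : Benjamin.Torus × ℝ → ℝ) (hv : Benjamin.MemL2L20 T v)
    (hsol : Benjamin.IsSolution α μ T v)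
    (hvc : ∀ᵐ p ∂(Benjamin.spaceTime T),
      p.1 ∈ (fun x : ℝ => (x : Benjamin.Torus)) '' Set.Ioo a b → v p = c p.2) :
    ∀ᵐ p ∂(Benjamin.spaceTime T), v p = 0 := by
  refine Benjamin.ae_eq_zero_of_pairing_eq_zero hv fun θ hθ k => ?_
  have hpos : ∀ n : ℕ, Benjamin.pairing T v θ n = 0 := by
    intro n
    rcases Nat.eq_zero_or_pos n with rfl | hn
    · exact Benjamin.pairing_zero hv hθ
    · exact Benjamin.pairing_eq_zero_of_pos hα.ne' hab hv hsol hvc hθ hn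
  rcases Int.eq_nat_or_neg k with ⟨n, rfl | rfl⟩
  · exact hpos n
  · rw [Benjamin.pairing_neg, hpos, map_zero]
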